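/- Let $p$ be a prime, let $X=\Delta_p$ be the additive topological group of $p$-adic integers, and let $\alpha$ be a topological automorphism of $X$, i.e. $\alpha x=cx$ for a $p$-adic unit $c=\sum_{n\ge 0}c_np^n$ with digits $c_n\in\{0,\dots,p-1\}$, $c_0\neq 0$. Let $m_K$ denote the normalized Haar measure of a compact subgroup $K$ of $X$, regarded as a distribution on $X$, and $E_x$ the distribution concentrated at $x\in X$. A distribution on $X$ is called degenerate if it equals $E_x$ for some $x\in X$, and idempotent if it is of the form $m_K*E_x$ with $K$ a compact subgroup of $X$ and $x\in X$. The following statements hold. 1. Let $\xi_1,\xi_2$ be independent random variables with values in $X$ and distributions $\mu_1,\mu_2$. Assume that the conditional distribution of $L_2=\xi_1+\alpha\xi_2$ given $L_1=\xi_1+\xi_2$ is symmetric (that is, invariant under $x\mapsto -x$ for almost all values of $L_1$). (i) If $p>2$ and $c_0\neq p-1$, then there are a compact subgroup $K$ of $X$ and $x_1,x_2\in X$ such that $\mu_j=m_K*E_{x_j}$, $j=1,2$. If moreover $c_0=1$, then $\mu_1$ and $\mu_2$ are degenerate. (ii) If $p=2$, $c_0=1$ and $c_1=0$, then $\mu_1$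 and $\mu_2$ are degenerate. 2. If either $p>2$ and $c_0=p-1$, or $p=2$ and $c_0=c_1=1$, then there exist independent random variables $\xi_1,\xi_2$ with values in $X$ and distributions $\mu_1,\mu_2$ such that the conditional distribution of $L_2=\xi_1+\alpha\xi_2$ given $L_1=\xi_1+\xi_2$ is symmetric, whereas neither $\mu_1$ nor $\mu_2$ is idempotent. -/

import Mathlib

open MeasureTheory ProbabilityTheory
open scoped MeasureTheory

/-- The `n`-th digit `x_n ∈ {0, …, p - 1}` in the canonical expansion `x = ∑ x_n p ^ n` of a
`p`-adic integer: the residue of `x` modulo `p ^ (n + 1)`, taken in `{0, …, p ^ (n + 1) - 1}`,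
divided by `p ^ n` with the remainder discarded. -/
noncomputable def padicDigit {p : ℕ} [Fact p.Prime] (x : ℤ_[p]) (n : ℕ) : ℕ :=
  (PadicInt.toZModPow (n + 1) x).val / p ^ n

/-- Every topological automorphism of the additive group of `p`-adic integers is the
multiplication by a unique unit. -/
theorem existsUnique_unit_eq_mul {p : ℕ} [Fact p.Prime] (α : ℤ_[p] ≃ₜ+ ℤ_[p]) :
    ∃! c : ℤ_[p]ˣ, ∀ x, α x = c * x := by
  have key : ∀ β : ℤ_[p] ≃ₜ+ ℤ_[p], ∀ x, β x = β 1 * x := by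
    intro β
    have h : (fun x => β x) = fun x => β 1 * x := by
      refine PadicInt.denseRange_natCast.equalizer β.continuous (by fun_prop) ?_
      funext n
      have := map_nsmul β n 1
      simpa [mul_comm] using this
    exact fun x => congrFun h x
  refine ⟨⟨α 1, α.symm 1, ?_, ?_⟩, ?_, ?_⟩
  · rw [← key]; simp
  · rw [mul_comm, ← key]; simp
  · exact key α
  · intro c hc
    ext
    simpa using (hc 1).symm

/-- The conditional distribution of `L₂` given `L₁` under `P` is symmetric: for almost all values
`t` of `L₁` the regular conditional distribution of `L₂` given `L₁ = t` is invariant under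
`x ↦ -x`. -/
def SymmetricCondDistrib {Ω X : Type*} [MeasurableSpace Ω] [MeasurableSpace X]
    [StandardBorelSpace X] [Nonempty X] [InvolutiveNeg X]
    (L₂ L₁ : Ω → X) (P : Measure Ω) [IsFiniteMeasure P] : Prop :=
  ∀ᵐ t ∂(P.map L₁), (condDistrib L₂ L₁ P t).IsNegInvariant

section Distributions

variable {X : Type*} [AddCommGroup X] [TopologicalSpace X] [IsTopologicalAddGroup X]
  [MeasurableSpace X] [BorelSpace X]

/-- The Haar distribution `m_K` of a compact subgroup `K` of `X`: the normalized Haar measure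
of `K`, regarded as a probability distribution on `X`. -/
noncomputable def haarDistribution (K : AddSubgroup X) [CompactSpace K] : Measure X :=
  (Measure.addHaarMeasure (⊤ : TopologicalSpace.PositiveCompacts K)).map ((↑) : K → X)

/-- `μ` is degenerate: it is concentrated at one point. -/
def IsDegenerateDistribution (μ : Measure X) : Prop :=
  ∃ x : X, μ = Measure.dirac x

/-- `μ ∈ I(X)`: `μ` is a shift of the Haar distribution of a compact subgroup of `X`. -/
def IsIdempotentDistribution (μ : Measure X) : Prop :=
  ∃ (K : AddSubgroup X) (_ : CompactSpace K) (x : X),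
    μ = haarDistribution K ∗ Measure.dirac x

end Distributions

/-! Symmetry says that `(L₁, L₂)` and `(L₁, -L₂)` have the same law. On characteristic functions f,
g of the two distributions this reads f(u + v) g(u + cv) = f(u - v) g(u - cv)
(`padicCharFun_heyde`). Taking u = -cv and u = v gives |f((1-c)v)| = |f((1+c)v)| |g(2cv)| and
|g((1-c)v)| = |g((1+c)v)| |f(2v)|. With κ = (1-c)/(1+c) integral, |f| and |g| therefore do not
increase from r to κr.

If p divides κ, iteration reaches the trivial character, so |f| = |g| = 1 and both distributions are
degenerate. If κ is a unit, it has finite order modulo p^n, so the inequalities are equalities.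
Cancelling, |g| = 1 where f ≠ 0 and conversely: f and g have the same support and modulus one on it,
which forces shifts of the Haar distribution of the annihilator of that support.

In the remaining case b = (1+c)/(1-c) is divisible by p. The involution that fixes x + y and negates
x + cy is then the swap modulo p, so it preserves the square of any distribution whose Haar density
depends only on the residue modulo p. Unequal masses on two residue classes exclude idempotence. -/

open scoped BoundedContinuousFunction

/-! ### Characters of the p-adic integers and characteristic functions. -/

section Characters

/-- The bounded continuous functions of a submonoid closed under conjugation and separating
points determine finite measures. -/
theorem ext_of_forall_mem_submonoid_integral_eq {E : Type*} [TopologicalSpace E] [PolishSpace E]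
    [MeasurableSpace E] [BorelSpace E] {P P' : Measure E} [IsFiniteMeasure P] [IsFiniteMeasure P']
    (M : Submonoid (E →ᵇ ℂ)) (hstar : ∀ f ∈ M, star f ∈ M)
    (hsep : ∀ x y, x ≠ y → ∃ f ∈ M, f x ≠ f y)
    (h : ∀ f ∈ M, ∫ x, f x ∂P = ∫ x, f x ∂P') : P = P' := by
  let A : StarSubalgebra ℂ (E →ᵇ ℂ) :=
    { Algebra.adjoin ℂ (M : Set (E →ᵇ ℂ)) with
      star_mem' := by
        intro a ha
        change star a ∈ Algebra.adjoin ℂ (M : Set (E →ᵇ ℂ))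
        induction ha using Algebra.adjoin_induction with
        | mem x hx => exact Algebra.subset_adjoin (hstar x hx)
        | algebraMap r =>
          rw [← algebraMap_star_comm]
          exact Subalgebra.algebraMap_mem _ _
        | add x y _ _ hx hy => rw [star_add]; exact add_mem hx hy
        | mul x y _ _ hx hy => rw [star_mul]; exact mul_mem hy hx }
  -- The algebra generated by a submonoid is its linear span, so linearity of the integral suffices.
  have hA : ∀ f, f ∈ A ↔ f ∈ Submodule.span ℂ (M : Set (E →ᵇ ℂ)) := by
    intro f
    have := Algebra.adjoin_eq_span ℂ (M : Set (E →ᵇ ℂ))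
    rw [Submonoid.closure_eq] at this
    rw [← this]
    rfl
  refine ext_of_forall_mem_subalgebra_integral_eq_of_polish (𝕜 := ℂ) (A := A) ?_ ?_
  · intro x y hxy
    obtain ⟨f, hf, hne⟩ := hsep x y hxy
    exact ⟨f, ⟨f.toContinuousMap, ⟨f, (hA f).2 (Submodule.subset_span hf), rfl⟩, rfl⟩, hne⟩
  · intro g hg
    rw [hA] at hg
    induction hg using Submodule.span_induction with
    | mem x hx => exact h x hx
    | zero => simp
    | add x y _ _ hx hy =>
      simp only [BoundedContinuousFunction.coe_add, Pi.add_apply]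
      rw [integral_add (x.integrable _) (y.integrable _),
        integral_add (x.integrable _) (y.integrable _), hx, hy]
    | smul a x _ hx =>
      simp only [BoundedContinuousFunction.coe_smul, integral_smul, hx]

variable {p : ℕ} [Fact p.Prime]

/-- The character `x ↦ exp (2πi x / p ^ n)` of the additive group of `p`-adic integers. -/
noncomputable def padicChar (p : ℕ) [Fact p.Prime] (n : ℕ) : AddChar ℤ_[p] ℂ :=
  (ZMod.stdAddChar (N := p ^ n)).compAddMonoidHom (PadicInt.toZModPow n).toAddMonoidHom

theorem padicChar_apply (n : ℕ) (x : ℤ_[p]) :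
    padicChar p n x = ZMod.stdAddChar (PadicInt.toZModPow n x) := rfl

theorem toZModPow_eq_iff {n : ℕ} {x y : ℤ_[p]} :
    PadicInt.toZModPow n x = PadicInt.toZModPow n y ↔ (p : ℤ_[p]) ^ n ∣ x - y := by
  rw [← Ideal.mem_span_singleton, ← PadicInt.ker_toZModPow, RingHom.mem_ker, map_sub, sub_eq_zero]

theorem padicChar_eq_iff {n : ℕ} {x y : ℤ_[p]} :
    padicChar p n x = padicChar p n y ↔ (p : ℤ_[p]) ^ n ∣ x - y := by
  rw [padicChar_apply, padicChar_apply, ZMod.injective_stdAddChar.eq_iff, toZModPow_eq_iff]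

theorem padicChar_eq_one_iff {n : ℕ} {x : ℤ_[p]} :
    padicChar p n x = 1 ↔ (p : ℤ_[p]) ^ n ∣ x := by
  rw [← AddChar.map_zero_eq_one (padicChar p n), padicChar_eq_iff, sub_zero]

theorem norm_padicChar (n : ℕ) (x : ℤ_[p]) : ‖padicChar p n x‖ = 1 := by
  rw [padicChar_apply, ZMod.stdAddChar_apply]
  exact Circle.norm_coe _

theorem star_padicChar (n : ℕ) (x : ℤ_[p]) : star (padicChar p n x) = padicChar p n (-x) := by
  rw [AddChar.map_neg_eq_inv, Complex.inv_eq_conj (norm_padicChar n x)]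
  rfl

theorem exists_natCast_pow_dvd_sub (n : ℕ) (x : ℤ_[p]) :
    ∃ m : ℕ, m < p ^ n ∧ (p : ℤ_[p]) ^ n ∣ x - m := by
  refine ⟨(PadicInt.toZModPow n x).val, ZMod.val_lt _, ?_⟩
  rw [← toZModPow_eq_iff]
  simp

/-- The pair (n, r) encodes the fraction r / p^n modulo integers, and cancelling p^k does not change
it. Passing to level n + k is how the dual group is divided by p^k. -/
theorem padicChar_add_pow_mul (n k : ℕ) (x : ℤ_[p]) :
    padicChar p (n + k) (p ^ k * x) = padicChar p n x := by
  obtain ⟨m, -, hm⟩ := exists_natCast_pow_dvd_sub n x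
  have h1 : padicChar p n x = padicChar p n m := padicChar_eq_iff.2 hm
  have h2 : padicChar p (n + k) (p ^ k * x) = padicChar p (n + k) (p ^ k * m) := by
    rw [padicChar_eq_iff, ← mul_sub, pow_add, mul_comm]
    exact mul_dvd_mul_left _ hm
  have hp : (p : ℂ) ≠ 0 := by exact_mod_cast (Fact.out : p.Prime).ne_zero
  have h3 := ZMod.stdAddChar_coe (N := p ^ n) (m : ℤ)
  have h4 := ZMod.stdAddChar_coe (N := p ^ (n + k)) ((p : ℤ) ^ k * m)
  push_cast at h3 h4
  rw [h1, h2, padicChar_apply, padicChar_apply]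
  simp only [map_mul, map_pow, map_natCast]
  rw [h3, h4]
  congr 1
  field_simp
  ring

theorem continuous_padicChar (n : ℕ) : Continuous (padicChar p n) := by
  refine IsLocallyConstant.continuous ((IsLocallyConstant.iff_exists_open _).2 fun x => ?_)
  -- Norms are powers of p, so the open ball of radius p^(-n+1) is the coset of p^n.
  refine ⟨Metric.ball x ((p : ℝ) ^ (-(n : ℤ) + 1)), Metric.isOpen_ball,
    Metric.mem_ball_self (zpow_pos (by exact_mod_cast (Fact.out : p.Prime).pos) _), ?_⟩
  intro y hy
  rw [padicChar_eq_iff, ← Ideal.mem_span_singleton, ← PadicInt.norm_le_pow_iff_mem_span_pow,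
    PadicInt.norm_le_pow_iff_norm_lt_pow_add_one]
  simpa [dist_eq_norm] using hy

/-- The multiples of the standard characters, as bounded continuous functions. -/
noncomputable def padicCharBCF (n : ℕ) (r : ℤ_[p]) : ℤ_[p] →ᵇ ℂ :=
  BoundedContinuousFunction.mkOfCompact
    ⟨fun x => padicChar p n (r * x), (continuous_padicChar n).comp (by fun_prop)⟩

@[simp]
theorem padicCharBCF_apply (n : ℕ) (r x : ℤ_[p]) :
    padicCharBCF n r x = padicChar p n (r * x) := rfl

/-- The submonoid of all characters of the additive group of `p`-adic integers. -/
noncomputable def padicCharSubmonoid (p : ℕ) [Fact p.Prime] : Submonoid (ℤ_[p] →ᵇ ℂ) where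
  carrier := {f | ∃ n r, f = padicCharBCF n r}
  one_mem' := ⟨0, 0, by ext; simp⟩
  mul_mem' := by
    rintro _ _ ⟨n, r, rfl⟩ ⟨m, s, rfl⟩
    refine ⟨n + m, p ^ m * r + p ^ n * s, ?_⟩
    ext x
    simp only [BoundedContinuousFunction.coe_mul, Pi.mul_apply, padicCharBCF_apply]
    rw [add_mul, AddChar.map_add_eq_mul, mul_assoc, mul_assoc, padicChar_add_pow_mul,
      add_comm n m, padicChar_add_pow_mul]

variable [MeasurableSpace ℤ_[p]]

/-- The characteristic function of a distribution on the `p`-adic integers. -/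
noncomputable def padicCharFun (μ : Measure ℤ_[p]) (n : ℕ) (r : ℤ_[p]) : ℂ :=
  ∫ x, padicChar p n (r * x) ∂μ

theorem padicCharFun_congr (μ : Measure ℤ_[p]) {n : ℕ} {r s : ℤ_[p]}
    (h : (p : ℤ_[p]) ^ n ∣ r - s) : padicCharFun μ n r = padicCharFun μ n s := by
  refine integral_congr_ae (.of_forall fun x => ?_)
  rw [padicChar_eq_iff, ← sub_mul]
  exact h.mul_right x

theorem padicCharFun_add_pow_mul (μ : Measure ℤ_[p]) (n k : ℕ) (r : ℤ_[p]) :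
    padicCharFun μ (n + k) (p ^ k * r) = padicCharFun μ n r := by
  simp only [padicCharFun, mul_assoc, padicChar_add_pow_mul]

theorem padicCharFun_zero (μ : Measure ℤ_[p]) [IsProbabilityMeasure μ] (n : ℕ) :
    padicCharFun μ n 0 = 1 := by
  simp [padicCharFun]

theorem norm_padicCharFun_neg (μ : Measure ℤ_[p]) (n : ℕ) (r : ℤ_[p]) :
    ‖padicCharFun μ n (-r)‖ = ‖padicCharFun μ n r‖ := by
  rw [← norm_star (padicCharFun μ n r), padicCharFun, padicCharFun, Complex.star_def,
    ← integral_conj]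
  congr 2
  funext x
  rw [neg_mul, ← star_padicChar]
  rfl

theorem norm_padicCharFun_le_one (μ : Measure ℤ_[p]) [IsProbabilityMeasure μ] (n : ℕ)
    (r : ℤ_[p]) : ‖padicCharFun μ n r‖ ≤ 1 := by
  refine (norm_integral_le_of_norm_le_const (C := 1) (.of_forall fun x => ?_)).trans ?_
  · rw [norm_padicChar]
  · simp

/-- A character whose mean has absolute value one is almost surely constant. -/
theorem exists_ae_eq_const_of_norm_padicCharFun_eq_one {μ : Measure ℤ_[p]} [IsProbabilityMeasure μ]
    {n : ℕ} {r : ℤ_[p]} (h : ‖padicCharFun μ n r‖ = 1) :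
    ∃ z : ℂ, ∀ᵐ x ∂μ, padicChar p n (r * x) = z := by
  rcases ae_eq_const_or_norm_integral_lt_of_norm_le_const (μ := μ) (C := 1)
    (f := fun x => padicChar p n (r * x))
    (.of_forall fun x => (norm_padicChar n _).le) with h1 | h1
  · exact ⟨_, h1⟩
  · simp only [probReal_univ, one_mul] at h1
    exact absurd h h1.ne

/-- Modulus one means that rx is almost surely constant modulo p^n, and then so is srx. -/
theorem norm_padicCharFun_mul_eq_one {μ : Measure ℤ_[p]} [IsProbabilityMeasure μ]
    {n : ℕ} {r : ℤ_[p]} (h : ‖padicCharFun μ n r‖ = 1) (s : ℤ_[p]) :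
    ‖padicCharFun μ n (s * r)‖ = 1 := by
  obtain ⟨z, hz⟩ := exists_ae_eq_const_of_norm_padicCharFun_eq_one h
  obtain ⟨y, hy⟩ := hz.exists
  have : ∀ᵐ x ∂μ, padicChar p n (s * r * x) = padicChar p n (s * r * y) := by
    filter_upwards [hz] with x hx
    rw [← hy, padicChar_eq_iff] at hx
    rw [padicChar_eq_iff, mul_assoc, mul_assoc, ← mul_sub]
    exact hx.mul_left s
  rw [padicCharFun, integral_congr_ae this]
  simp [norm_padicChar]

/-- Every residue modulo p^n is almost surely constant; countably many such residues determine the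
point. -/
theorem isDegenerateDistribution_of_norm_padicCharFun {μ : Measure ℤ_[p]} [IsProbabilityMeasure μ]
    (h : ∀ n r, ‖padicCharFun μ n r‖ = 1) : IsDegenerateDistribution μ := by
  choose z hz using fun n => exists_ae_eq_const_of_norm_padicCharFun_eq_one (h n 1)
  have hz' := ae_all_iff.2 hz
  obtain ⟨x, hx⟩ := hz'.exists
  refine ⟨x, ?_⟩
  have : id =ᵐ[μ] fun _ => x := by
    filter_upwards [hz'] with y hy
    refine PadicInt.ext_of_toZModPow.1 fun n => ZMod.injective_stdAddChar ?_
    have := (hy n).trans (hx n).symm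
    rwa [one_mul, one_mul] at this
  rw [← Measure.map_id (μ := μ), Measure.map_congr this, Measure.map_const]
  simp

variable [BorelSpace ℤ_[p]]

theorem ext_of_padicCharFun_eq {μ ν : Measure ℤ_[p]} [IsFiniteMeasure μ] [IsFiniteMeasure ν]
    (h : ∀ n r, padicCharFun μ n r = padicCharFun ν n r) : μ = ν := by
  refine ext_of_forall_mem_submonoid_integral_eq (padicCharSubmonoid p) ?_ ?_ ?_
  · rintro _ ⟨n, r, rfl⟩
    refine ⟨n, -r, ?_⟩
    ext x
    rw [padicCharBCF_apply, neg_mul, ← star_padicChar]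
    rfl
  · intro x y hxy
    by_contra! hc
    refine hxy (PadicInt.ext_of_toZModPow.1 fun n => ?_)
    have := hc _ ⟨n, 1, rfl⟩
    rw [padicCharBCF_apply, padicCharBCF_apply, one_mul, one_mul] at this
    exact ZMod.injective_stdAddChar this
  · rintro _ ⟨n, r, rfl⟩
    exact h n r

end Characters

/-! ### Haar distributions of compact subgroups. -/

section Haar

variable {X : Type*} [AddCommGroup X] [TopologicalSpace X] [IsTopologicalAddGroup X]
  [MeasurableSpace X] [BorelSpace X]

instance isProbabilityMeasure_addHaarMeasure_top {G : Type*} [AddGroup G] [TopologicalSpace G]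
    [IsTopologicalAddGroup G] [MeasurableSpace G] [BorelSpace G] [CompactSpace G] [Nonempty G] :
    IsProbabilityMeasure
      (Measure.addHaarMeasure (⊤ : TopologicalSpace.PositiveCompacts G)) :=
  ⟨by simpa using Measure.addHaarMeasure_self (K₀ := (⊤ : TopologicalSpace.PositiveCompacts G))⟩

instance isProbabilityMeasure_haarDistribution (K : AddSubgroup X) [CompactSpace K] :
    IsProbabilityMeasure (haarDistribution K) :=
  Measure.isProbabilityMeasure_map measurable_subtype_coe.aemeasurable

theorem haarDistribution_conv_dirac_apply [SecondCountableTopology X] (K : AddSubgroup X)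
    [CompactSpace K] (x : X) {s : Set X} (hs : MeasurableSet s) :
    (haarDistribution K ∗ Measure.dirac x) s =
      Measure.addHaarMeasure (⊤ : TopologicalSpace.PositiveCompacts K) {k : K | (k : X) + x ∈ s} := by
  have h1 : Measurable fun y : X => y + x := by fun_prop
  have h2 : Measurable ((↑) : K → X) := measurable_subtype_coe
  rw [Measure.conv_dirac, Measure.map_apply h1 hs, haarDistribution,
    Measure.map_apply h2 (h1 hs)]
  rfl

/-- A distribution concentrated on a coset of `K` and invariant under `K` is the shifted Haar
distribution of `K`. -/
theorem eq_haarDistribution_conv_dirac [SecondCountableTopology X] {μ : Measure X}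
    [IsProbabilityMeasure μ] (K : AddSubgroup X) [CompactSpace K] {x : X}
    (hinv : ∀ k ∈ K, μ.map (· + k) = μ) (hx : ∀ᵐ y ∂μ, y - x ∈ K) :
    μ = haarDistribution K ∗ Measure.dirac x := by
  ext s hs
  rw [haarDistribution_conv_dirac_apply K x hs]
  set m := Measure.addHaarMeasure (⊤ : TopologicalSpace.PositiveCompacts K)
  have hm : Measurable fun q : X × K => s.indicator (1 : X → ENNReal) (q.1 + q.2) := by
    refine (measurable_one.indicator hs).comp ?_
    exact measurable_fst.add (measurable_subtype_coe.comp measurable_snd)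
  -- The double integral of the indicator of s at y + k is computed in both orders: invariance of μ
  -- gives one value, invariance of Haar measure on K the other.
  have h1 : ∫⁻ k : K, ∫⁻ y, s.indicator 1 (y + k) ∂μ ∂m = μ s := by
    have : ∀ k : K, ∫⁻ y, s.indicator (1 : X → ENNReal) (y + k) ∂μ = μ s := by
      intro k
      rw [← lintegral_map (f := s.indicator (1 : X → ENNReal)) (measurable_one.indicator hs)
        (by fun_prop : Measurable fun y : X => y + (k : X)), hinv k k.2, lintegral_indicator_one hs]
    simp [this]
  have h2 : ∫⁻ y, ∫⁻ k : K, s.indicator (1 : X → ENNReal) (y + k) ∂m ∂μ =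
      m {k : K | (k : X) + x ∈ s} := by
    have : ∀ᵐ y ∂μ, ∫⁻ k : K, s.indicator (1 : X → ENNReal) (y + k) ∂m =
        m {k : K | (k : X) + x ∈ s} := by
      filter_upwards [hx] with y hy
      have hms : MeasurableSet {k : K | (k : X) + x ∈ s} :=
        (measurable_subtype_coe.add_const x) hs
      rw [← lintegral_indicator_one hms,
        ← lintegral_add_left_eq_self (μ := m) ({k : K | (k : X) + x ∈ s}.indicator 1) (⟨y - x, hy⟩ : K)]
      refine lintegral_congr fun k => ?_
      have e : y - x + (k : X) + x = y + k := by abel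
      have hiff : (⟨y - x, hy⟩ : K) + k ∈ {k : K | (k : X) + x ∈ s} ↔ y + (k : X) ∈ s := by
        rw [← e]
        rfl
      by_cases hmem : y + (k : X) ∈ s
      · rw [Set.indicator_of_mem hmem, Set.indicator_of_mem (hiff.2 hmem)]
        rfl
      · rw [Set.indicator_of_notMem hmem, Set.indicator_of_notMem (mt hiff.1 hmem)]
    rw [lintegral_congr_ae this]
    simp
  rw [← h1, ← h2, lintegral_lintegral_swap]
  exact (hm.comp measurable_swap).aemeasurable

end Haar

/-- The conditional distribution of `L₂` given `L₁` is symmetric exactly when the pairs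
`(L₁, L₂)` and `(L₁, -L₂)` are identically distributed. -/
theorem symmetricCondDistrib_iff_map_eq {Ω X : Type*} [MeasurableSpace Ω] [MeasurableSpace X]
    [StandardBorelSpace X] [Nonempty X] [InvolutiveNeg X] [MeasurableNeg X]
    {L₂ L₁ : Ω → X} {P : Measure Ω} [IsFiniteMeasure P] (h₂ : Measurable L₂) :
    SymmetricCondDistrib L₂ L₁ P ↔
      P.map (fun ω => (L₁ ω, L₂ ω)) = P.map (fun ω => (L₁ ω, -L₂ ω)) := by
  have hneg : Measurable (Neg.neg : X → X) := measurable_neg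
  -- The conditional distribution of -L₂ is almost surely the reflection of that of L₂.
  have h1 := condDistrib_comp (mβ := inferInstance) L₁ (μ := P) h₂.aemeasurable hneg
  have h2 : P.map L₁ ⊗ₘ (condDistrib L₂ L₁ P).map Neg.neg =
      P.map (fun ω => (L₁ ω, -L₂ ω)) := by
    rw [← Measure.compProd_congr h1, compProd_map_condDistrib (hneg.comp h₂).aemeasurable]
    rfl
  rw [← h2, ← condDistrib_ae_eq_iff_measure_eq_compProd L₁ h₂.aemeasurable]
  refine Filter.eventually_congr (.of_forall fun t => ?_)
  rw [Kernel.map_apply _ hneg]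
  exact ⟨fun h => h.neg_eq_self.symm, fun h => ⟨h.symm⟩⟩

/-! ### The functional equation, and idempotence read off from characteristic functions. -/

section Heyde

variable {p : ℕ} [Fact p.Prime] [MeasurableSpace ℤ_[p]] [BorelSpace ℤ_[p]]

/-- The functional equation for the characteristic functions of two independent random variables
for which the conditional distribution of `ξ₁ + c ξ₂` given `ξ₁ + ξ₂` is symmetric. -/
theorem padicCharFun_heyde {Ω : Type*} [MeasurableSpace Ω] {P : Measure Ω}
    [IsProbabilityMeasure P] {ξ₁ ξ₂ : Ω → ℤ_[p]} {c : ℤ_[p]} (h₁ : Measurable ξ₁)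
    (h₂ : Measurable ξ₂) (hind : IndepFun ξ₁ ξ₂ P)
    (hsymm : SymmetricCondDistrib (fun ω => ξ₁ ω + c * ξ₂ ω) (fun ω => ξ₁ ω + ξ₂ ω) P)
    (n : ℕ) (u v : ℤ_[p]) :
    padicCharFun (P.map ξ₁) n (u + v) * padicCharFun (P.map ξ₂) n (u + c * v) =
      padicCharFun (P.map ξ₁) n (u - v) * padicCharFun (P.map ξ₂) n (u - c * v) := by
  have hχ : ∀ r : ℤ_[p], Continuous fun x => padicChar p n (r * x) := fun r =>
    (continuous_padicChar n).comp (by fun_prop)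
  have hprod : ∀ r s : ℤ_[p], padicCharFun (P.map ξ₁) n r * padicCharFun (P.map ξ₂) n s =
      ∫ ω, padicChar p n (r * ξ₁ ω + s * ξ₂ ω) ∂P := by
    intro r s
    simp only [padicCharFun, AddChar.map_add_eq_mul]
    rw [integral_map h₁.aemeasurable (hχ r).aestronglyMeasurable,
      integral_map h₂.aemeasurable (hχ s).aestronglyMeasurable]
    exact (hind.integral_fun_comp_mul_comp h₁.aemeasurable h₂.aemeasurable
      (hχ r).aestronglyMeasurable (hχ s).aestronglyMeasurable).symm
  have hL₁ : Measurable fun ω => ξ₁ ω + ξ₂ ω := h₁.add h₂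
  have hL₂ : Measurable fun ω => ξ₁ ω + c * ξ₂ ω := h₁.add (h₂.const_mul c)
  have hL₂' : Measurable fun ω => -(ξ₁ ω + c * ξ₂ ω) := hL₂.neg
  rw [symmetricCondDistrib_iff_map_eq hL₂] at hsymm
  have hf : Continuous fun q : ℤ_[p] × ℤ_[p] => padicChar p n (u * q.1 + v * q.2) :=
    (continuous_padicChar n).comp (by fun_prop)
  -- Integrating the character (u, v) against both joint laws; ux + vy regroups by ξ₁ and ξ₂, and
  -- independence splits it.
  have key := congrArg (fun m => ∫ q, padicChar p n (u * q.1 + v * q.2) ∂m) hsymm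
  beta_reduce at key
  rw [integral_map (hL₁.prodMk hL₂).aemeasurable hf.aestronglyMeasurable,
    integral_map (hL₁.prodMk hL₂').aemeasurable hf.aestronglyMeasurable] at key
  rw [hprod, hprod]
  convert key using 4 <;> ring

variable {μ ν : Measure ℤ_[p]} [IsProbabilityMeasure μ] [IsProbabilityMeasure ν]

/-- If the characteristic function of a distribution has only the absolute values `0` and `1`,
then the distribution is the shifted Haar distribution of the annihilator of its support. -/
theorem exists_eq_haarDistribution_conv_dirac
    (hμ : ∀ n r, padicCharFun μ n r ≠ 0 → ‖padicCharFun μ n r‖ = 1) (K : AddSubgroup ℤ_[p])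
    [CompactSpace K]
    (hK : ∀ k, k ∈ K ↔ ∀ (n r : ℕ), padicCharFun μ n r ≠ 0 → padicChar p n (r * k) = 1) :
    ∃ x, μ = haarDistribution K ∗ Measure.dirac x := by
  have hae : ∀ᵐ y ∂μ, ∀ n r : ℕ, padicCharFun μ n r ≠ 0 →
      ∃ z, (∀ᵐ x ∂μ, padicChar p n (r * x) = z) ∧ padicChar p n (r * y) = z := by
    refine ae_all_iff.2 fun n => ae_all_iff.2 fun r => ?_
    by_cases h0 : padicCharFun μ n r = 0
    · simp [h0]
    · obtain ⟨z, hz⟩ := exists_ae_eq_const_of_norm_padicCharFun_eq_one (hμ n r h0)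
      filter_upwards [hz] with y hy _ using ⟨z, hz, hy⟩
  obtain ⟨x, hx⟩ := hae.exists
  refine ⟨x, eq_haarDistribution_conv_dirac K ?_ ?_⟩
  -- Shifting by k multiplies the characteristic function by a character value that is 1 wherever
  -- the function is nonzero.
  · intro k hk
    have : IsProbabilityMeasure (μ.map (· + k)) :=
      Measure.isProbabilityMeasure_map (by fun_prop : Measurable (· + k)).aemeasurable
    refine ext_of_padicCharFun_eq fun n r => ?_
    have hc : Continuous fun x => padicChar p n (r * x) :=
      (continuous_padicChar n).comp (by fun_prop)
    rw [padicCharFun, integral_map (by fun_prop : Measurable (· + k)).aemeasurable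
      hc.aestronglyMeasurable]
    simp only [mul_add, AddChar.map_add_eq_mul]
    rw [integral_mul_const, ← padicCharFun]
    -- K is cut out by natural frequencies only, which is enough since r matters only modulo p^n.
    obtain ⟨m, -, hm⟩ := exists_natCast_pow_dvd_sub n r
    rcases eq_or_ne (padicCharFun μ n r) 0 with h0 | h0
    · rw [h0, zero_mul]
    · have : padicChar p n (r * k) = 1 := by
        rw [← (hK k).1 hk n m (by rwa [← padicCharFun_congr μ hm]), padicChar_eq_iff, ← sub_mul]
        exact hm.mul_right k
      rw [this, mul_one]
  · filter_upwards [hae] with y hy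
    rw [hK]
    intro n r h0
    obtain ⟨z, hz, hyz⟩ := hy n r h0
    obtain ⟨z', hz', hxz⟩ := hx n r h0
    obtain ⟨w, hw, hw'⟩ := (hz.and hz').exists
    rw [padicChar_eq_one_iff, mul_sub, ← padicChar_eq_iff, hyz, hxz, ← hw, hw']

/-- The subgroup is the annihilator of the support of the characteristic function, so equal supports
yield the same K. -/
theorem exists_eq_haarDistribution_conv_dirac_of_support_eq
    (hμ : ∀ n r, padicCharFun μ n r ≠ 0 → ‖padicCharFun μ n r‖ = 1)
    (hν : ∀ n r, padicCharFun ν n r ≠ 0 → ‖padicCharFun ν n r‖ = 1)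
    (hsupp : ∀ n r, padicCharFun μ n r ≠ 0 ↔ padicCharFun ν n r ≠ 0) :
    ∃ (K : AddSubgroup ℤ_[p]) (_ : CompactSpace K) (x₁ x₂ : ℤ_[p]),
      μ = haarDistribution K ∗ Measure.dirac x₁ ∧ ν = haarDistribution K ∗ Measure.dirac x₂ := by
  let K : AddSubgroup ℤ_[p] :=
    { carrier := {k | ∀ (n r : ℕ), padicCharFun μ n r ≠ 0 → padicChar p n (r * k) = 1}
      zero_mem' := by simp
      add_mem' := by
        intro a b ha hb n r h
        rw [mul_add, AddChar.map_add_eq_mul, ha n r h, hb n r h, one_mul]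
      neg_mem' := by
        intro a ha n r h
        rw [mul_neg, AddChar.map_neg_eq_inv, ha n r h, inv_one] }
  have hclosed : IsClosed (K : Set ℤ_[p]) := by
    change IsClosed {k : ℤ_[p] | ∀ (n r : ℕ), padicCharFun μ n r ≠ 0 → padicChar p n (r * k) = 1}
    simp only [Set.ofPred_forall]
    exact isClosed_iInter fun n => isClosed_iInter fun r => isClosed_iInter fun _ =>
      isClosed_eq ((continuous_padicChar n).comp (by fun_prop)) continuous_const
  have hK : CompactSpace K := isCompact_iff_compactSpace.1 hclosed.isCompact
  obtain ⟨x₁, h₁⟩ := exists_eq_haarDistribution_conv_dirac hμ K fun k => Iff.rfl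
  obtain ⟨x₂, h₂⟩ := exists_eq_haarDistribution_conv_dirac hν K fun k => by
    simp only [← hsupp]
    rfl
  exact ⟨K, hK, x₁, x₂, h₁, h₂⟩

end Heyde

/-! ### Contraction of the moduli along r ↦ κr. -/

section Inequalities

variable {p : ℕ} [Fact p.Prime] [MeasurableSpace ℤ_[p]] {μ ν : Measure ℤ_[p]} {c κ : ℤ_[p]}

/-- The choice u = -cv turns one factor into ν̂(0) = 1. -/
theorem norm_padicCharFun_first [IsProbabilityMeasure ν]
    (h : ∀ n u v, padicCharFun μ n (u + v) * padicCharFun ν n (u + c * v) =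
      padicCharFun μ n (u - v) * padicCharFun ν n (u - c * v)) (n : ℕ) (v : ℤ_[p]) :
    ‖padicCharFun μ n ((1 - c) * v)‖ =
      ‖padicCharFun μ n ((1 + c) * v)‖ * ‖padicCharFun ν n (2 * c * v)‖ := by
  have := congrArg norm (h n (-(c * v)) v)
  rw [norm_mul, norm_mul, neg_add_cancel, padicCharFun_zero, norm_one, mul_one] at this
  rw [← norm_padicCharFun_neg μ n ((1 + c) * v), ← norm_padicCharFun_neg ν n (2 * c * v)]
  convert this using 4 <;> ring

theorem norm_padicCharFun_second [IsProbabilityMeasure μ]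
    (h : ∀ n u v, padicCharFun μ n (u + v) * padicCharFun ν n (u + c * v) =
      padicCharFun μ n (u - v) * padicCharFun ν n (u - c * v)) (n : ℕ) (v : ℤ_[p]) :
    ‖padicCharFun ν n ((1 - c) * v)‖ =
      ‖padicCharFun ν n ((1 + c) * v)‖ * ‖padicCharFun μ n (2 * v)‖ := by
  have := congrArg norm (h n v v)
  rw [norm_mul, norm_mul, sub_self, padicCharFun_zero, norm_one, one_mul, mul_comm] at this
  rw [show (1 - c) * v = v - c * v by ring, ← this]
  congr 4 <;> ring

/-- Here 1 + c need not be invertible. With (1+c)e = p^j, the choice v = er at level n + j makes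
(1+c)v represent r at level n. -/
theorem norm_padicCharFun_mul_le {j : ℕ} (hκ : 1 - c = κ * (1 + c)) (hj : 1 + c ∣ (p : ℤ_[p]) ^ j)
    (h : ∀ n v, ‖padicCharFun μ n ((1 - c) * v)‖ ≤ ‖padicCharFun μ n ((1 + c) * v)‖)
    (n : ℕ) (r : ℤ_[p]) : ‖padicCharFun μ n (κ * r)‖ ≤ ‖padicCharFun μ n r‖ := by
  obtain ⟨e, he⟩ := hj
  have := h (n + j) (e * r)
  rw [← padicCharFun_add_pow_mul μ n j r, ← padicCharFun_add_pow_mul μ n j (κ * r), he]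
  convert this using 3
  · rw [hκ]; ring
  · ring

theorem norm_padicCharFun_pow_mul_le
    (h : ∀ n r, ‖padicCharFun μ n (κ * r)‖ ≤ ‖padicCharFun μ n r‖) (n i : ℕ) (r : ℤ_[p]) :
    ‖padicCharFun μ n (κ ^ i * r)‖ ≤ ‖padicCharFun μ n r‖ := by
  induction i with
  | zero => simp
  | succ i ih =>
    rw [pow_succ', mul_assoc]
    exact (h n _).trans ih

/-- After n iterations κ^n r vanishes modulo p^n, where the characteristic function is 1. -/
theorem norm_padicCharFun_eq_one_of_dvd [IsProbabilityMeasure μ] (hκ : (p : ℤ_[p]) ∣ κ)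
    (h : ∀ n r, ‖padicCharFun μ n (κ * r)‖ ≤ ‖padicCharFun μ n r‖) (n : ℕ) (r : ℤ_[p]) :
    ‖padicCharFun μ n r‖ = 1 := by
  refine le_antisymm (norm_padicCharFun_le_one μ n r) ?_
  have h1 := norm_padicCharFun_pow_mul_le h n n r
  rwa [padicCharFun_congr μ (s := 0), padicCharFun_zero, norm_one] at h1
  rw [sub_zero]
  exact (pow_dvd_pow_of_dvd hκ n).mul_right r

/-- Modulo p^n the orbit of r under κ is a cycle, so a quantity nonincreasing along it is constant.
-/
theorem norm_padicCharFun_mul_eq_of_isUnit (hκ : IsUnit κ)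
    (h : ∀ n r, ‖padicCharFun μ n (κ * r)‖ ≤ ‖padicCharFun μ n r‖) (n : ℕ) (r : ℤ_[p]) :
    ‖padicCharFun μ n (κ * r)‖ = ‖padicCharFun μ n r‖ := by
  refine le_antisymm (h n r) ?_
  obtain ⟨u, rfl⟩ := hκ
  set w := Units.map (PadicInt.toZModPow (p := p) n).toMonoidHom u with hw
  have hpos := orderOf_pos w
  have h1 := norm_padicCharFun_pow_mul_le h n (orderOf w - 1) (u * r)
  rw [← mul_assoc, ← pow_succ, Nat.sub_add_cancel hpos] at h1
  rwa [padicCharFun_congr μ (s := r)] at h1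
  rw [← toZModPow_eq_iff, map_mul, map_pow]
  have h2 := congrArg Units.val (pow_orderOf_eq_one w)
  simp only [Units.val_pow_eq_pow_val, Units.val_one] at h2
  have h3 : (w : ZMod (p ^ n)) = PadicInt.toZModPow n (u : ℤ_[p]) := rfl
  rw [← h3, h2, one_mul]

end Inequalities

/-! ### Digit conditions translated into divisibility. -/

section Digits

variable {p : ℕ} [Fact p.Prime]

theorem padicInt_isUnit_iff_not_dvd {x : ℤ_[p]} : IsUnit x ↔ ¬ (p : ℤ_[p]) ∣ x := by
  rw [← PadicInt.norm_lt_one_iff_dvd, PadicInt.isUnit_iff, not_lt]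
  exact ⟨fun h => h.ge, fun h => le_antisymm x.norm_le_one h⟩

theorem padicDigit_zero_lt (x : ℤ_[p]) : padicDigit x 0 < p := by
  have := ZMod.val_lt (PadicInt.toZModPow (p := p) (0 + 1) x)
  simpa [padicDigit] using this

theorem exists_eq_padicDigit_zero_add (x : ℤ_[p]) :
    ∃ y : ℤ_[p], x = padicDigit x 0 + p * y := by
  have h : PadicInt.toZModPow (p := p) 1 x = PadicInt.toZModPow 1 (padicDigit x 0 : ℤ_[p]) := by
    simp [padicDigit]
  obtain ⟨y, hy⟩ := toZModPow_eq_iff.1 h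
  exact ⟨y, by linear_combination hy⟩

theorem exists_eq_padicDigit_zero_add_padicDigit_one_add (x : ℤ_[p]) :
    ∃ y : ℤ_[p], x = padicDigit x 0 + p * padicDigit x 1 + p ^ 2 * y := by
  set m := (PadicInt.toZModPow (p := p) 2 x).val with hm
  have h : PadicInt.toZModPow (p := p) 2 x = PadicInt.toZModPow 2 (m : ℤ_[p]) := by
    simp [hm]
  obtain ⟨y, hy⟩ := toZModPow_eq_iff.1 h
  have h0 : padicDigit x 0 = m % p := by
    have h1 : PadicInt.toZModPow (p := p) 1 x = PadicInt.toZModPow 1 (m : ℤ_[p]) :=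
      toZModPow_eq_iff.2 ⟨p * y, by linear_combination hy⟩
    rw [map_natCast] at h1
    have h2 := congrArg ZMod.val h1
    rw [ZMod.val_natCast] at h2
    simpa [padicDigit] using h2
  have h1 : padicDigit x 1 = m / p := by simp [padicDigit, hm]
  have h2 : ((m % p + p * (m / p) : ℕ) : ℤ_[p]) = m := by rw [Nat.mod_add_div]
  push_cast at h2
  refine ⟨y, ?_⟩
  rw [h0, h1]
  linear_combination hy - h2

theorem isUnit_one_add_of_padicDigit_ne {x : ℤ_[p]} (h : padicDigit x 0 ≠ p - 1) :
    IsUnit (1 + x) := by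
  rw [padicInt_isUnit_iff_not_dvd]
  intro hd
  obtain ⟨y, hy⟩ := exists_eq_padicDigit_zero_add x
  have h1 : (p : ℤ_[p]) ∣ ((1 + padicDigit x 0 : ℕ) : ℤ_[p]) := by
    push_cast
    rw [show (1 : ℤ_[p]) + padicDigit x 0 = 1 + x - p * y by linear_combination -hy]
    exact dvd_sub hd (dvd_mul_right _ _)
  rw [← PadicInt.norm_lt_one_iff_dvd, PadicInt.norm_natCast_lt_one_iff] at h1
  have := padicDigit_zero_lt x
  have := Nat.le_of_dvd (by omega) h1
  omega

theorem isUnit_two_of_two_lt (hp : 2 < p) : IsUnit (2 : ℤ_[p]) := by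
  rw [padicInt_isUnit_iff_not_dvd, ← PadicInt.norm_lt_one_iff_dvd]
  intro h
  have h1 : ‖((2 : ℕ) : ℤ_[p])‖ < 1 := by exact_mod_cast h
  rw [PadicInt.norm_natCast_lt_one_iff] at h1
  exact absurd (Nat.le_of_dvd two_pos h1) (by omega)

theorem exists_one_sub_eq_mul_one_add_of_padicDigit {c : ℤ_[p]} (hp : p = 2)
    (h0 : padicDigit c 0 = 1) (h1 : padicDigit c 1 = 0) :
    ∃ κ : ℤ_[p], 1 - c = κ * (1 + c) ∧ (p : ℤ_[p]) ∣ κ ∧ 1 + c ∣ (p : ℤ_[p]) ^ 1 := by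
  obtain ⟨y, hy⟩ := exists_eq_padicDigit_zero_add_padicDigit_one_add c
  rw [h0, h1] at hy
  have hp2 : (p : ℤ_[p]) = 2 := by exact_mod_cast hp
  have hu : IsUnit (1 + (p : ℤ_[p]) * y) := by
    rw [padicInt_isUnit_iff_not_dvd]
    intro hd
    rw [dvd_add_left (dvd_mul_right _ _)] at hd
    exact PadicInt.p_nonunit (isUnit_of_dvd_one hd)
  obtain ⟨e, he⟩ := hu.exists_right_inv
  rw [hp2] at hy he ⊢
  push_cast at hy
  -- Here c = 1 + 4y, so 1 - c = -4y and 1 + c = 2(1 + 2y), with e inverse to 1 + 2y.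
  refine ⟨2 * (-y * e), ?_, dvd_mul_right _ _, e, ?_⟩
  · linear_combination (-1 + 2 * y * e) * hy + 4 * y * he
  · linear_combination (-e) * hy - 2 * he

theorem exists_dvd_one_sub_mul_eq_one_add_of_padicDigit {c : ℤ_[p]}
    (h : (2 < p ∧ padicDigit c 0 = p - 1) ∨
      (p = 2 ∧ padicDigit c 0 = 1 ∧ padicDigit c 1 = 1)) :
    ∃ b : ℤ_[p], (p : ℤ_[p]) ∣ b ∧ (1 - c) * b = 1 + c := by
  rcases h with ⟨hp, h0⟩ | ⟨hp, h0, h1⟩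
  · obtain ⟨y, hy⟩ := exists_eq_padicDigit_zero_add c
    have hp1 : ((p - 1 : ℕ) : ℤ_[p]) = p - 1 := by
      rw [Nat.cast_sub (by omega), Nat.cast_one]
    rw [h0, hp1] at hy
    have hu : IsUnit (1 - c) := by
      rw [padicInt_isUnit_iff_not_dvd]
      intro hd
      rw [show 1 - c = 2 - p * (1 + y) by linear_combination -hy,
        dvd_sub_left (dvd_mul_right _ _)] at hd
      exact padicInt_isUnit_iff_not_dvd.1 (isUnit_two_of_two_lt hp) hd
    obtain ⟨e, he⟩ := hu.exists_right_inv
    exact ⟨p * ((1 + y) * e), dvd_mul_right _ _,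
      by linear_combination p * (1 + y) * he - hy⟩
  · obtain ⟨y, hy⟩ := exists_eq_padicDigit_zero_add_padicDigit_one_add c
    rw [h0, h1] at hy
    have hp2 : (p : ℤ_[p]) = 2 := by exact_mod_cast hp
    have hu : IsUnit (1 + (p : ℤ_[p]) * y) := by
      rw [padicInt_isUnit_iff_not_dvd]
      intro hd
      rw [dvd_add_left (dvd_mul_right _ _)] at hd
      exact PadicInt.p_nonunit (isUnit_of_dvd_one hd)
    obtain ⟨e, he⟩ := hu.exists_right_inv
    rw [hp2] at hy he ⊢
    push_cast at hy
    -- Here c = 3 + 4y, so 1 + c = 4(1 + y) and 1 - c = -2(1 + 2y).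
    refine ⟨2 * (-(1 + y) * e), dvd_mul_right _ _, ?_⟩
    linear_combination (-1 + 2 * (1 + y) * e) * hy + 4 * (1 + y) * he

end Digits

/-! ### Degenerate and idempotent conclusions. -/

section Characterization

variable {p : ℕ} [Fact p.Prime] [MeasurableSpace ℤ_[p]]
  {μ ν : Measure ℤ_[p]} [IsProbabilityMeasure μ] [IsProbabilityMeasure ν] {c κ : ℤ_[p]}

theorem norm_padicCharFun_eq_one_of_heyde {j : ℕ}
    (h : ∀ n u v, padicCharFun μ n (u + v) * padicCharFun ν n (u + c * v) =
      padicCharFun μ n (u - v) * padicCharFun ν n (u - c * v))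
    (hκ : 1 - c = κ * (1 + c)) (hj : 1 + c ∣ (p : ℤ_[p]) ^ j) (hdvd : (p : ℤ_[p]) ∣ κ) :
    (∀ n r, ‖padicCharFun μ n r‖ = 1) ∧ ∀ n r, ‖padicCharFun ν n r‖ = 1 := by
  refine ⟨norm_padicCharFun_eq_one_of_dvd hdvd (norm_padicCharFun_mul_le hκ hj fun n v => ?_),
    norm_padicCharFun_eq_one_of_dvd hdvd (norm_padicCharFun_mul_le hκ hj fun n v => ?_)⟩
  · rw [norm_padicCharFun_first h]
    exact mul_le_of_le_one_right (norm_nonneg _) (norm_padicCharFun_le_one _ _ _)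
  · rw [norm_padicCharFun_second h]
    exact mul_le_of_le_one_right (norm_nonneg _) (norm_padicCharFun_le_one _ _ _)

theorem norm_padicCharFun_eq_one_of_isUnit_mul {n : ℕ} {r s : ℤ_[p]} (hs : IsUnit s)
    (h : ‖padicCharFun μ n (s * r)‖ = 1) : ‖padicCharFun μ n r‖ = 1 := by
  obtain ⟨e, he⟩ := hs.exists_left_inv
  have := norm_padicCharFun_mul_eq_one h e
  rwa [← mul_assoc, he, one_mul] at this

theorem exists_eq_haarDistribution_of_heyde [BorelSpace ℤ_[p]]
    (h : ∀ n u v, padicCharFun μ n (u + v) * padicCharFun ν n (u + c * v) =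
      padicCharFun μ n (u - v) * padicCharFun ν n (u - c * v))
    (hc : IsUnit c) (h2 : IsUnit (2 : ℤ_[p])) (hu : IsUnit (1 + c)) :
    ∃ (K : AddSubgroup ℤ_[p]) (_ : CompactSpace K) (x₁ x₂ : ℤ_[p]),
      μ = haarDistribution K ∗ Measure.dirac x₁ ∧ ν = haarDistribution K ∗ Measure.dirac x₂ := by
  obtain ⟨e, he⟩ := hu.exists_right_inv
  have heu : IsUnit e := .of_mul_eq_one (1 + c) (by rw [mul_comm, he])
  have hκ : 1 - c = (1 - c) * e * (1 + c) := by linear_combination -(1 - c) * he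
  have hj : 1 + c ∣ (p : ℤ_[p]) ^ 0 := by simpa using hu.dvd
  by_cases hd : (p : ℤ_[p]) ∣ 1 - c
  · obtain ⟨hμ, hν⟩ := norm_padicCharFun_eq_one_of_heyde h hκ hj (hd.mul_right e)
    refine exists_eq_haarDistribution_conv_dirac_of_support_eq (fun n r _ => hμ n r)
      (fun n r _ => hν n r) fun n r => ?_
    rw [← norm_ne_zero_iff, ← norm_ne_zero_iff (a := padicCharFun ν n r), hμ, hν]
  · have hκu : IsUnit ((1 - c) * e) := (padicInt_isUnit_iff_not_dvd.2 hd).mul heu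
    have hle : ∀ (a b s : ℝ), s ≤ 1 → 0 ≤ b → a = b * s → a ≤ b := fun a b s hs hb hab =>
      hab ▸ mul_le_of_le_one_right hb hs
    have hμκ := norm_padicCharFun_mul_eq_of_isUnit (μ := μ) hκu
      (norm_padicCharFun_mul_le hκ hj fun n v => hle _ _ _ (norm_padicCharFun_le_one ν n _)
        (norm_nonneg _) (norm_padicCharFun_first h n v))
    have hνκ := norm_padicCharFun_mul_eq_of_isUnit (μ := ν) hκu
      (norm_padicCharFun_mul_le hκ hj fun n v => hle _ _ _ (norm_padicCharFun_le_one μ n _)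
        (norm_nonneg _) (norm_padicCharFun_second h n v))
    -- With v = r/(1+c) and |f(κr)| = |f(r)| ≠ 0, cancelling leaves |g| = 1 at a unit multiple of r.
    have hμν : ∀ n r, padicCharFun μ n r ≠ 0 → ‖padicCharFun ν n r‖ = 1 := by
      intro n r h0
      have := norm_padicCharFun_first h n (e * r)
      rw [← mul_assoc, ← mul_assoc, ← mul_assoc, he, one_mul, hμκ] at this
      exact norm_padicCharFun_eq_one_of_isUnit_mul ((h2.mul hc).mul heu)
        (mul_left_cancel₀ (norm_ne_zero_iff.2 h0) (by rw [← this, mul_one]))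
    have hνμ : ∀ n r, padicCharFun ν n r ≠ 0 → ‖padicCharFun μ n r‖ = 1 := by
      intro n r h0
      have := norm_padicCharFun_second h n (e * r)
      rw [← mul_assoc, ← mul_assoc, ← mul_assoc, he, one_mul, hνκ] at this
      exact norm_padicCharFun_eq_one_of_isUnit_mul (h2.mul heu)
        (mul_left_cancel₀ (norm_ne_zero_iff.2 h0) (by rw [← this, mul_one]))
    have hne : ∀ z : ℂ, ‖z‖ = 1 → z ≠ 0 := fun z hz => by
      rw [← norm_ne_zero_iff, hz]
      exact one_ne_zero
    exact exists_eq_haarDistribution_conv_dirac_of_support_eq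
      (fun n r h0 => hνμ n r (hne _ (hμν n r h0))) (fun n r h0 => hμν n r (hne _ (hνμ n r h0)))
      fun n r => ⟨fun h0 => hne _ (hμν n r h0), fun h0 => hne _ (hνμ n r h0)⟩

end Characterization

/-! ### A non-idempotent pair with symmetric conditional distribution. -/

section Counterexample

theorem MeasureTheory.MeasurePreserving.map_withDensity {S : Type*} [MeasurableSpace S]
    {M : Measure S} {T : S → S} (hT : MeasurePreserving T M M) {g : S → ENNReal}
    (hg : Measurable g) (hgT : ∀ q, g (T q) = g q) :
    (M.withDensity g).map T = M.withDensity g := by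
  ext s hs
  rw [Measure.map_apply hT.measurable hs, withDensity_apply _ (hT.measurable hs),
    withDensity_apply _ hs, ← hT.setLIntegral_comp_preimage hs hg]
  simp only [hgT]

variable {p : ℕ} [Fact p.Prime]

/-- The coset of `a` modulo `p`. -/
def residueClass (p : ℕ) [Fact p.Prime] (a : ℤ_[p]) : Set ℤ_[p] := {x | (p : ℤ_[p]) ∣ x - a}

theorem mem_residueClass {a x : ℤ_[p]} : x ∈ residueClass p a ↔ (p : ℤ_[p]) ∣ x - a := Iff.rfl

theorem isOpen_residueClass (a : ℤ_[p]) : IsOpen (residueClass p a) := by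
  have : residueClass p a = Metric.ball a 1 := by
    ext x
    rw [mem_residueClass, ← PadicInt.norm_lt_one_iff_dvd, Metric.mem_ball, dist_eq_norm]
  rw [this]
  exact Metric.isOpen_ball

theorem disjoint_residueClass : Disjoint (residueClass p 0) (residueClass p 1) := by
  rw [Set.disjoint_left]
  intro x h0 h1
  rw [mem_residueClass, sub_zero] at h0
  rw [mem_residueClass, dvd_sub_right h0] at h1
  exact PadicInt.p_nonunit (isUnit_of_dvd_one h1)

/-- The involution of pairs of `p`-adic integers preserving `x + y` and reversing the sign of
`x + c y`, when `(1 - c) b = 1 + c`. -/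
noncomputable def heydeInvolution (b : ℤ_[p]) : ℤ_[p] × ℤ_[p] →+ ℤ_[p] × ℤ_[p] where
  toFun q := (q.2 - b * (q.1 + q.2), q.1 + b * (q.1 + q.2))
  map_zero' := by simp
  map_add' x y := by
    ext1
    · simp only [Prod.fst_add, Prod.snd_add]; ring
    · simp only [Prod.fst_add, Prod.snd_add]; ring

theorem heydeInvolution_apply (b : ℤ_[p]) (q : ℤ_[p] × ℤ_[p]) :
    heydeInvolution b q = (q.2 - b * (q.1 + q.2), q.1 + b * (q.1 + q.2)) := rfl

theorem heydeInvolution_involutive (b : ℤ_[p]) : Function.Involutive (heydeInvolution b) := by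
  intro q
  simp only [heydeInvolution_apply]
  ext1
  · ring
  · ring

theorem continuous_heydeInvolution (b : ℤ_[p]) : Continuous (heydeInvolution b) := by
  change Continuous fun q : ℤ_[p] × ℤ_[p] => (q.2 - b * (q.1 + q.2), q.1 + b * (q.1 + q.2))
  fun_prop

variable [MeasurableSpace ℤ_[p]]

/-- The density, with respect to Haar measure, giving the masses `1 / 3` and `2 / 3` to the
residue classes of `0` and `1`. -/
noncomputable def residueDensity (m : Measure ℤ_[p]) (x : ℤ_[p]) : ENNReal :=
  (residueClass p 0).indicator (fun _ => 3⁻¹ * (m (residueClass p 0))⁻¹) x +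
    (residueClass p 1).indicator (fun _ => 2 * 3⁻¹ * (m (residueClass p 1))⁻¹) x

theorem residueDensity_congr (m : Measure ℤ_[p]) {x y : ℤ_[p]} (h : (p : ℤ_[p]) ∣ x - y) :
    residueDensity m x = residueDensity m y := by
  have : ∀ a, x ∈ residueClass p a ↔ y ∈ residueClass p a := fun a => by
    rw [mem_residueClass, mem_residueClass, show x - a = x - y + (y - a) by ring,
      dvd_add_right h]
  classical
  simp only [residueDensity, Set.indicator_apply, this]

theorem residueClass_measure_inv_mul (m : Measure ℤ_[p]) [m.IsAddHaarMeasure] (a : ℤ_[p]) :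
    (m (residueClass p a))⁻¹ * m (residueClass p a) = 1 :=
  ENNReal.inv_mul_cancel
    ((isOpen_residueClass a).measure_pos m ⟨a, by simp [mem_residueClass]⟩).ne'
    (measure_ne_top _ _)

variable [BorelSpace ℤ_[p]]

/-- An idempotent distribution gives the same mass to all cosets modulo `p` that it charges. -/
theorem IsIdempotentDistribution.measure_residueClass_eq {μ : Measure ℤ_[p]}
    (h : IsIdempotentDistribution μ) {a b : ℤ_[p]} (ha : μ (residueClass p a) ≠ 0)
    (hb : μ (residueClass p b) ≠ 0) : μ (residueClass p a) = μ (residueClass p b) := by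
  obtain ⟨K, _, x, rfl⟩ := h
  rw [haarDistribution_conv_dirac_apply K x (isOpen_residueClass _).measurableSet] at *
  obtain ⟨k, hk⟩ := nonempty_of_measure_ne_zero ha
  obtain ⟨l, hl⟩ := nonempty_of_measure_ne_zero hb
  -- Translation by k - l inside K carries one charged coset onto the other.
  rw [haarDistribution_conv_dirac_apply K x (isOpen_residueClass _).measurableSet,
    ← measure_preimage_add_right _ (k - l)]
  congr 1
  ext m
  simp only [Set.mem_ofPred_eq, Set.mem_preimage, mem_residueClass, AddSubgroup.coe_add,
    AddSubgroup.coe_sub] at hk hl ⊢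
  rw [show (m : ℤ_[p]) + (k - l) + x - a = (m + x - b) + ((k + x - a) - (l + x - b)) by ring,
    dvd_add_left (dvd_sub hk hl)]

theorem measurable_residueDensity (m : Measure ℤ_[p]) : Measurable (residueDensity m) :=
  (measurable_const.indicator (isOpen_residueClass 0).measurableSet).add
    (measurable_const.indicator (isOpen_residueClass 1).measurableSet)

theorem withDensity_residueDensity_apply (m : Measure ℤ_[p]) {s : Set ℤ_[p]} (hs : MeasurableSet s) :
    m.withDensity (residueDensity m) s =
      3⁻¹ * (m (residueClass p 0))⁻¹ * m (residueClass p 0 ∩ s) +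
        2 * 3⁻¹ * (m (residueClass p 1))⁻¹ * m (residueClass p 1 ∩ s) := by
  have h0 := (isOpen_residueClass (p := p) 0).measurableSet
  have h1 := (isOpen_residueClass (p := p) 1).measurableSet
  rw [withDensity_apply _ hs]
  simp only [residueDensity]
  rw [lintegral_add_left (measurable_const.indicator h0), lintegral_indicator_const h0,
    lintegral_indicator_const h1, Measure.restrict_apply h0, Measure.restrict_apply h1]

variable (m : Measure ℤ_[p]) [m.IsAddHaarMeasure]

theorem withDensity_residueDensity_zero :
    m.withDensity (residueDensity m) (residueClass p 0) = 3⁻¹ := by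
  rw [withDensity_residueDensity_apply m (isOpen_residueClass 0).measurableSet, Set.inter_self,
    disjoint_residueClass.symm.inter_eq, measure_empty, mul_zero, add_zero, mul_assoc,
    residueClass_measure_inv_mul, mul_one]

theorem withDensity_residueDensity_one :
    m.withDensity (residueDensity m) (residueClass p 1) = 2 * 3⁻¹ := by
  rw [withDensity_residueDensity_apply m (isOpen_residueClass 1).measurableSet, Set.inter_self,
    disjoint_residueClass.inter_eq, measure_empty, mul_zero, zero_add, mul_assoc,
    residueClass_measure_inv_mul, mul_one]

instance isProbabilityMeasure_withDensity_residueDensity :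
    IsProbabilityMeasure (m.withDensity (residueDensity m)) := by
  constructor
  rw [withDensity_residueDensity_apply m .univ, Set.inter_univ, Set.inter_univ, mul_assoc,
    residueClass_measure_inv_mul, mul_assoc (2 * 3⁻¹), residueClass_measure_inv_mul, mul_one,
    mul_one, show (3⁻¹ : ENNReal) + 2 * 3⁻¹ = 3 * 3⁻¹ by ring]
  exact ENNReal.mul_inv_cancel (by simp) (by simp)

theorem not_isIdempotentDistribution_withDensity_residueDensity :
    ¬ IsIdempotentDistribution (m.withDensity (residueDensity m)) := by
  intro h
  have h3 : (3⁻¹ : ENNReal) ≠ 0 := by simp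
  have := h.measure_residueClass_eq (a := 0) (b := 1)
  rw [withDensity_residueDensity_zero, withDensity_residueDensity_one] at this
  have h1 := this h3 (by simp)
  have h2 : (1 : ENNReal) * 3⁻¹ = 2 * 3⁻¹ := by rw [one_mul]; exact h1
  rw [ENNReal.mul_left_inj h3 (by simp)] at h2
  norm_num at h2

/-- Haar measure is preserved because the involution is a continuous surjective endomorphism of a
compact group; the product density is preserved because p ∣ b makes the involution the swap modulo
p. -/
theorem map_heydeInvolution {b : ℤ_[p]} (hb : (p : ℤ_[p]) ∣ b) :
    ((m.withDensity (residueDensity m)).prod (m.withDensity (residueDensity m))).map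
      (heydeInvolution b) =
    (m.withDensity (residueDensity m)).prod (m.withDensity (residueDensity m)) := by
  have hρ := measurable_residueDensity m
  rw [prod_withDensity hρ hρ]
  refine MeasurePreserving.map_withDensity ?_ ?_ fun q => ?_
  · exact AddMonoidHom.measurePreserving (continuous_heydeInvolution b)
      (heydeInvolution_involutive b).surjective rfl
  · exact (hρ.comp measurable_fst).mul (hρ.comp measurable_snd)
  · rw [heydeInvolution_apply, mul_comm]
    congr 1
    · exact residueDensity_congr m (by simpa using hb.mul_right _)
    · exact residueDensity_congr m (by simpa using hb.mul_right _)

theorem symmetricCondDistrib_withDensity_residueDensity {b c : ℤ_[p]} (hb : (p : ℤ_[p]) ∣ b)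
    (hc : (1 - c) * b = 1 + c) :
    SymmetricCondDistrib (fun q : ℤ_[p] × ℤ_[p] => q.1 + c * q.2) (fun q => q.1 + q.2)
      ((m.withDensity (residueDensity m)).prod (m.withDensity (residueDensity m))) := by
  have h1 : Measurable fun q : ℤ_[p] × ℤ_[p] => (q.1 + q.2, q.1 + c * q.2) :=
    (by fun_prop : Continuous fun q : ℤ_[p] × ℤ_[p] => (q.1 + q.2, q.1 + c * q.2)).measurable
  rw [symmetricCondDistrib_iff_map_eq
    (by fun_prop : Continuous fun q : ℤ_[p] × ℤ_[p] => q.1 + c * q.2).measurable]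
  conv_lhs => rw [← map_heydeInvolution m hb]
  rw [Measure.map_map h1 (continuous_heydeInvolution b).measurable]
  congr 1
  funext q
  simp only [Function.comp_apply, heydeInvolution_apply]
  ext1
  · ring
  · linear_combination (-(q.1 + q.2)) * hc

end Counterexample

/-! ### Assembly of both statements. -/

theorem theorem2 (p : ℕ) [Fact p.Prime] [MeasurableSpace ℤ_[p]] [BorelSpace ℤ_[p]]
    (α : ℤ_[p] ≃ₜ+ ℤ_[p]) (c : ℤ_[p]ˣ) (hα : ∀ x, α x = c * x) :
    -- Statement 1
    (∀ (Ω : Type*) [MeasurableSpace Ω] (P : Measure Ω) [IsProbabilityMeasure P]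
        (ξ₁ ξ₂ : Ω → ℤ_[p]) (μ₁ μ₂ : Measure ℤ_[p]),
        Measurable ξ₁ → Measurable ξ₂ → IndepFun ξ₁ ξ₂ P →
        P.map ξ₁ = μ₁ → P.map ξ₂ = μ₂ →
        SymmetricCondDistrib (fun ω => ξ₁ ω + α (ξ₂ ω)) (fun ω => ξ₁ ω + ξ₂ ω) P →
        -- 1(i)
        (2 < p → padicDigit (c : ℤ_[p]) 0 ≠ p - 1 →
          (∃ (K : AddSubgroup ℤ_[p]) (_ : CompactSpace K) (x₁ x₂ : ℤ_[p]),
            μ₁ = haarDistribution K ∗ Measure.dirac x₁ ∧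
            μ₂ = haarDistribution K ∗ Measure.dirac x₂) ∧
          (padicDigit (c : ℤ_[p]) 0 = 1 →
            IsDegenerateDistribution μ₁ ∧ IsDegenerateDistribution μ₂)) ∧
        -- 1(ii)
        (p = 2 → padicDigit (c : ℤ_[p]) 0 = 1 → padicDigit (c : ℤ_[p]) 1 = 0 →
          IsDegenerateDistribution μ₁ ∧ IsDegenerateDistribution μ₂)) ∧
    -- Statement 2
    ((2 < p ∧ padicDigit (c : ℤ_[p]) 0 = p - 1) ∨
        (p = 2 ∧ padicDigit (c : ℤ_[p]) 0 = 1 ∧ padicDigit (c : ℤ_[p]) 1 = 1) →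
      ∃ (Ω : Type) (_ : MeasurableSpace Ω) (P : Measure Ω) (_ : IsProbabilityMeasure P)
        (ξ₁ ξ₂ : Ω → ℤ_[p]) (μ₁ μ₂ : Measure ℤ_[p]),
        Measurable ξ₁ ∧ Measurable ξ₂ ∧ IndepFun ξ₁ ξ₂ P ∧
        P.map ξ₁ = μ₁ ∧ P.map ξ₂ = μ₂ ∧
        SymmetricCondDistrib (fun ω => ξ₁ ω + α (ξ₂ ω)) (fun ω => ξ₁ ω + ξ₂ ω) P ∧
        ¬ IsIdempotentDistribution μ₁ ∧ ¬ IsIdempotentDistribution μ₂) := by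
  refine ⟨fun Ω _ P _ ξ₁ ξ₂ μ₁ μ₂ h₁ h₂ hind hμ₁ hμ₂ hsymm => ?_, fun hdig => ?_⟩
  · subst hμ₁ hμ₂
    have := Measure.isProbabilityMeasure_map (μ := P) h₁.aemeasurable
    have := Measure.isProbabilityMeasure_map (μ := P) h₂.aemeasurable
    simp only [hα] at hsymm
    have heq := padicCharFun_heyde h₁ h₂ hind hsymm
    refine ⟨fun hp h0 => ?_, fun hp h0 h1 => ?_⟩
    · have hu := isUnit_one_add_of_padicDigit_ne h0
      refine ⟨exists_eq_haarDistribution_of_heyde heq c.isUnit (isUnit_two_of_two_lt hp) hu,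
        fun h01 => ?_⟩
      obtain ⟨e, he⟩ := hu.exists_right_inv
      obtain ⟨y, hy⟩ := exists_eq_padicDigit_zero_add (c : ℤ_[p])
      rw [h01, Nat.cast_one] at hy
      -- Here c = 1 + py and e inverts 1 + c, so κ = (1-c)e = -pye.
      obtain ⟨hμ, hν⟩ := norm_padicCharFun_eq_one_of_heyde (j := 0) (κ := (p : ℤ_[p]) * (-y * e)) heq
        (by linear_combination (-1 : ℤ_[p]) * hy + (p : ℤ_[p]) * y * he) (by simpa using hu.dvd)
        (dvd_mul_right _ _)
      exact ⟨isDegenerateDistribution_of_norm_padicCharFun hμ,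
        isDegenerateDistribution_of_norm_padicCharFun hν⟩
    · obtain ⟨κ, hκ, hdvd, hj⟩ := exists_one_sub_eq_mul_one_add_of_padicDigit hp h0 h1
      obtain ⟨hμ, hν⟩ := norm_padicCharFun_eq_one_of_heyde heq hκ hj hdvd
      exact ⟨isDegenerateDistribution_of_norm_padicCharFun hμ,
        isDegenerateDistribution_of_norm_padicCharFun hν⟩
  · obtain ⟨b, hb, hcb⟩ := exists_dvd_one_sub_mul_eq_one_add_of_padicDigit hdig
    let m : Measure ℤ_[p] := Measure.addHaarMeasure ⊤
    let μ : Measure ℤ_[p] := m.withDensity (residueDensity m)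
    refine ⟨ℤ_[p] × ℤ_[p], inferInstance, μ.prod μ, inferInstance, Prod.fst, Prod.snd, μ, μ,
      measurable_fst, measurable_snd, indepFun_prod measurable_id measurable_id, ?_, ?_, ?_,
      not_isIdempotentDistribution_withDensity_residueDensity m,
      not_isIdempotentDistribution_withDensity_residueDensity m⟩
    · exact Measure.map_fst_prod.trans (by simp)
    · exact Measure.map_snd_prod.trans (by simp)
    · simp only [hα]
      exact symmetricCondDistrib_withDensity_residueDensity m hb hcb
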